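/- Let $(\mathcal H,\langle\cdot,\cdot\rangle)$ be a separable real Hilbert space with norm $\|\cdot\|$. Let $X$ be an $\mathcal H$-valued random element and $Y,\varepsilon$ real random variables on a probability space such that, for some fixed $\Theta\in\mathcal H$, $b\in\mathbb R$ and $\sigma^2\in[0,\infty)$, $$Y=\langle\Theta,X\rangle+b+\varepsilon\ \text{ a.s.},\qquad E(\varepsilon\mid X)=0,\qquad E(\varepsilon^2\mid X)=\sigma^2\ \text{ a.s.},\qquad E(\|X\|^4)<\infty .$$ Write $\mu_X=E(X)$, $\mu_Y=E(Y)$. For an $\mathcal H$-valued random element $V$ with $E(\|V\|^2)<\infty$ and mean $\mu_V$ let $\Gamma_V(h)=E(\langle V-\mu_V,h\rangle(V-\mu_V))$, $h\in\mathcal H$, be its covariance operator, and put $\Gamma=\Gamma_X$. Let $\Delta(h)=E(\langle X-\mu_X,h\rangle(Y-\mu_Y))$, $h\in\mathcal H$, be the cross-covariance functional of $X$ and $Y$, an element of the dual space $\mathcal H'$ with dual norm $\|\cdot\|'$. Let $(X_1,Y_1),(X_2,Y_2),\dots$ be i.i.d. with the same distribution as $(X,Y)$ and $$T_n=\frac1n\sum_{i=1}^n(X_i-\overline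 X)(Y_i-\overline Y),\qquad \overline X=\frac1n\sum_{i=1}^nX_i,\quad \overline Y=\frac1n\sum_{i=1}^nY_i .$$ If the null hypothesis $H_0:\|\Delta\|'=0$ holds, then $E(\|(X-\mu_X)\varepsilon\|^2)<\infty$, $\Gamma_{(X-\mu_X)\varepsilon}=\sigma^2\Gamma$, there is a centred Gaussian element of $\mathcal H$ with this covariance operator, and for every such element $Z_{(X-\mu_X)\varepsilon}$, as $n\to\infty$, $\sqrt n\,T_n$ converges in law to $Z_{(X-\mu_X)\varepsilon}$ in $\mathcal H$; consequently, $\|\sqrt n\,T_n\|$ converges in law to $\|Z_{(X-\mu_X)\varepsilon}\|$. -/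

import Mathlib

open MeasureTheory ProbabilityTheory Filter Topology

/-- The covariance operator `Γ_Z h = E(⟨Z - μ_Z, h⟩ (Z - μ_Z))` of a (square integrable) random
element `Z`, where `μ_Z = E(Z)`. -/
noncomputable def covOp {Ω H : Type*} [MeasurableSpace Ω] [NormedAddCommGroup H]
    [InnerProductSpace ℝ H] (Z : Ω → H) (P : Measure Ω) : H → H :=
  fun h ↦ ∫ ω, (inner ℝ (Z ω - ∫ ω', Z ω' ∂P) h) • (Z ω - ∫ ω', Z ω' ∂P) ∂P

theorem integrable_inner_mul_sub {Ω H : Type*} [MeasurableSpace Ω] [NormedAddCommGroup H]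
    [InnerProductSpace ℝ H] {X : Ω → H} {Y : Ω → ℝ} {P : Measure Ω} [IsFiniteMeasure P]
    (hX : MemLp X 2 P) (hY : MemLp Y 2 P) (a : H) (b : ℝ) (h : H) :
    Integrable (fun ω ↦ inner ℝ (X ω - a) h * (Y ω - b)) P :=
  ((hX.sub (memLp_const a)).inner_const h).integrable_mul (hY.sub (memLp_const b))

open Classical in
/-- The cross-covariance functional `Δ h = E(⟨X - μ_X, h⟩ (Y - μ_Y))` of square integrable `X`
and `Y`, as an element of the dual space, whose norm is the dual norm. It is only meaningful for
square integrable `X` and `Y`, and is set to `0` otherwise. -/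
noncomputable def crossCov {Ω H : Type*} [MeasurableSpace Ω] [NormedAddCommGroup H]
    [InnerProductSpace ℝ H] (X : Ω → H) (Y : Ω → ℝ) (P : Measure Ω) [IsFiniteMeasure P] :
    StrongDual ℝ H :=
  if hXY : MemLp X 2 P ∧ MemLp Y 2 P then
    LinearMap.mkContinuous
      { toFun := fun h ↦
          ∫ ω, inner ℝ (X ω - ∫ ω', X ω' ∂P) h * (Y ω - ∫ ω', Y ω' ∂P) ∂P
        map_add' := fun h k ↦ by
          rw [← integral_add (integrable_inner_mul_sub hXY.1 hXY.2 _ _ h)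
            (integrable_inner_mul_sub hXY.1 hXY.2 _ _ k)]
          simp only [inner_add_right, add_mul]
        map_smul' := fun c h ↦ by
          simp only [inner_smul_right, mul_assoc, RingHom.id_apply, smul_eq_mul]
          exact integral_const_mul _ _ }
      (∫ ω, ‖X ω - ∫ ω', X ω' ∂P‖ * ‖Y ω - ∫ ω', Y ω' ∂P‖ ∂P)
      (fun h ↦ by
        rw [← integral_mul_const]
        refine norm_integral_le_of_norm_le ?_ (Eventually.of_forall fun ω ↦ ?_)
        · exact ((hXY.1.sub (memLp_const _)).norm.integrable_mul
            (hXY.2.sub (memLp_const _)).norm).mul_const _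
        · rw [norm_mul]
          calc _ ≤ (‖X ω - ∫ ω', X ω' ∂P‖ * ‖h‖) * ‖Y ω - ∫ ω', Y ω' ∂P‖ := by
                gcongr
                exact norm_inner_le_norm _ _
            _ = _ := by ring)
  else 0

theorem crossCov_apply {Ω H : Type*} [MeasurableSpace Ω] [NormedAddCommGroup H]
    [InnerProductSpace ℝ H] {X : Ω → H} {Y : Ω → ℝ} {P : Measure Ω} [IsFiniteMeasure P]
    (hX : MemLp X 2 P) (hY : MemLp Y 2 P) (h : H) :
    crossCov X Y P h =
      ∫ ω, inner ℝ (X ω - ∫ ω', X ω' ∂P) h * (Y ω - ∫ ω', Y ω' ∂P) ∂P := by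
  rw [crossCov, dif_pos ⟨hX, hY⟩]
  rfl

/-- The sample mean of the first `n` elements of a sequence. -/
noncomputable def sampleMean {E : Type*} [AddCommGroup E] [Module ℝ E] (x : ℕ → E) (n : ℕ) : E :=
  (n : ℝ)⁻¹ • ∑ i ∈ Finset.range n, x i

/-- The statistic `T_n = (1/n) ∑ (X_i - X̄) (Y_i - Ȳ)` of the first `n` pairs of a sample. -/
noncomputable def empCrossCov {H : Type*} [AddCommGroup H] [Module ℝ H]
    (x : ℕ → H) (y : ℕ → ℝ) (n : ℕ) : H :=
  (n : ℝ)⁻¹ • ∑ i ∈ Finset.range n, (y i - sampleMean y n) • (x i - sampleMean x n)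

/-- `Z` is a centred Gaussian element of `H` with covariance operator `C`. -/
structure IsCenteredGaussian {Ω H : Type*} [MeasurableSpace Ω] [NormedAddCommGroup H]
    [InnerProductSpace ℝ H] [MeasurableSpace H] (Z : Ω → H) (Q : Measure Ω) (C : H → H) :
    Prop where
  gaussian : HasGaussianLaw Z Q
  mean : ∫ ω, Z ω ∂Q = 0
  cov : covOp Z Q = C

/-!
The null hypothesis, tested in the direction of the slope `Θ`, says that `⟨Θ, X - μ_X⟩` has second
moment zero: the error is uncorrelated with `X`, so the cross-covariance at `Θ` is the variance of
`⟨Θ, X⟩`. Hence `Y - μ_Y = ε` almost surely, `T_n` is formed from the errors alone, and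
`√n T_n = n^{-1/2} ∑ (Y_i - μ_Y)(X_i - μ_X) - n^{-1/2} A_n B_n`, where `A_n` and `B_n` are the
normalised sums of the centred `Y_i` and `X_i`. These are bounded in `L²`, so the second term
vanishes in the limit (`tendstoInMeasure_inv_sqrt_smul_smul`), and the first is a normalised sum of
i.i.d. copies of `(X - μ_X) ε`, to which the central limit theorem in `H` applies.

The condition `E(ε² | X) = σ²` means that the image under `X` of the measure with density `ε²` is
`σ²` times the law of `X` (`map_withDensity_sq_of_condExp_sq_eq`). This gives both the square
integrability of `(X - μ_X) ε` and its covariance operator.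

The central limit theorem in a separable Hilbert space
(`exists_isCenteredGaussian_and_tendstoInDistribution`) comes from tightness and the
convergence of characteristic functions. The laws of the normalised sums are tight since the second
moment of a component of the sum is at most that of the same component of one summand, which is
small for components orthogonal to a large finite-dimensional subspace. Their characteristic
functions converge by the one-dimensional theorem. By Prokhorov's theorem there is then a limit
law; it is Gaussian, which also proves that the Gaussian element exists, and every other centred
Gaussian element with the same covariance operator has the same characteristic function
(`IsCenteredGaussian.map_eq`).
-/

/-! ### Second moments of sums of independent centred random elements -/

section SecondMoments

theorem lintegral_enorm_sq_eq_ofReal {E Ω : Type*} [NormedAddCommGroup E] [MeasurableSpace Ω]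
    {P : Measure Ω} {f : Ω → E} (hf : MemLp f 2 P) :
    ∫⁻ ω, ‖f ω‖ₑ ^ 2 ∂P = ENNReal.ofReal (∫ ω, ‖f ω‖ ^ 2 ∂P) := by
  rw [ofReal_integral_eq_lintegral_ofReal (hf.integrable_norm_pow two_ne_zero)
    (ae_of_all _ fun ω ↦ by positivity)]
  simp_rw [ENNReal.ofReal_pow (norm_nonneg _), ofReal_norm]

variable {H : Type*} [NormedAddCommGroup H] [InnerProductSpace ℝ H] [CompleteSpace H]
  [MeasurableSpace H] [BorelSpace H] {Ω : Type*} [MeasurableSpace Ω] {P : Measure Ω}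

/-- Independent centred random elements are orthogonal in `L²`, so that the second moments of
their sums add up. -/
theorem integral_norm_sum_sq [IsFiniteMeasure P] {ι : Type*} {W : ι → Ω → H}
    (hindep : Pairwise fun i j ↦ IndepFun (W i) (W j) P)
    (hL2 : ∀ i, MemLp (W i) 2 P) (h0 : ∀ i, ∫ ω, W i ω ∂P = 0) (s : Finset ι) :
    ∫ ω, ‖∑ i ∈ s, W i ω‖ ^ 2 ∂P = ∑ i ∈ s, ∫ ω, ‖W i ω‖ ^ 2 ∂P := by
  classical
  have hint (i j : ι) : Integrable (fun ω ↦ inner ℝ (W i ω) (W j ω)) P :=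
    ((hL2 i).norm.integrable_mul (hL2 j).norm).mono'
      ((hL2 i).aestronglyMeasurable.inner (hL2 j).aestronglyMeasurable)
      (ae_of_all _ fun _ ↦ norm_inner_le_norm _ _)
  -- The square of the norm of the sum is expanded, and only the diagonal terms survive.
  simp_rw [← real_inner_self_eq_norm_sq, sum_inner, inner_sum]
  rw [integral_finsetSum _ fun i _ ↦ integrable_finsetSum _ fun j _ ↦ hint i j]
  refine Finset.sum_congr rfl fun i hi ↦ ?_
  rw [integral_finsetSum _ fun j _ ↦ hint i j, Finset.sum_eq_single_of_mem i hi]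
  intro j _ hji
  have := (hindep hji.symm).integral_bilin ((hL2 i).integrable (by norm_num))
    ((hL2 j).integrable (by norm_num)) (innerSL ℝ)
  exact this.trans (by simp [h0])

/-- Equality holds except for the empty sum. -/
theorem integral_norm_inv_sqrt_smul_sum_sq_le [IsFiniteMeasure P] {W : ℕ → Ω → H}
    (hindep : iIndepFun W P) (hident : ∀ i, IdentDistrib (W i) (W 0) P P)
    (hL2 : MemLp (W 0) 2 P) (h0 : ∫ ω, W 0 ω ∂P = 0) (n : ℕ) :
    ∫ ω, ‖(√(n : ℝ))⁻¹ • ∑ i ∈ Finset.range n, W i ω‖ ^ 2 ∂P ≤ ∫ ω, ‖W 0 ω‖ ^ 2 ∂P := by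
  have hsq (i : ℕ) : ∫ ω, ‖W i ω‖ ^ 2 ∂P = ∫ ω, ‖W 0 ω‖ ^ 2 ∂P :=
    ((hident i).comp (u := fun x ↦ ‖x‖ ^ 2) (by fun_prop)).integral_eq
  simp_rw [norm_smul, mul_pow]
  rw [integral_const_mul, integral_norm_sum_sq (fun i j hij ↦ hindep.indepFun hij)
    (fun i ↦ (hident i).memLp_iff.2 hL2) (fun i ↦ (hident i).integral_eq.trans h0)]
  simp only [hsq, Finset.sum_const, Finset.card_range, nsmul_eq_mul, norm_inv, Real.norm_eq_abs,
    inv_pow, sq_abs, Real.sq_sqrt (Nat.cast_nonneg n)]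
  rcases eq_or_ne n 0 with rfl | hn
  · simpa using integral_nonneg fun ω ↦ by positivity
  · rw [inv_mul_cancel_left₀ (by exact_mod_cast hn)]

end SecondMoments

/-! ### Tightness in Hilbert spaces -/

theorem measure_compl_setOf_le_le {α : Type*} [MeasurableSpace α] {μ : Measure α}
    {f : α → ENNReal} (hf : AEMeasurable f μ) {a c : ENNReal} (ha : a ≠ 0) (ha' : a ≠ ⊤)
    (h : ∫⁻ x, f x ∂μ ≤ c * a) : μ {x | f x ≤ a}ᶜ ≤ c := by
  have hsub : {x | f x ≤ a}ᶜ ⊆ {x | a ≤ f x} := fun x hx ↦ by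
    rw [Set.mem_compl_iff, Set.mem_ofPred_eq, not_le] at hx
    exact hx.le
  exact (measure_mono hsub).trans
    ((meas_ge_le_lintegral_div hf ha ha').trans (ENNReal.div_le_of_le_mul h))

section Tightness

variable {H : Type*} [NormedAddCommGroup H] [InnerProductSpace ℝ H]

/-- A bounded closed set whose elements are uniformly approximated by their projections to
finite-dimensional subspaces is compact. -/
theorem isCompact_of_forall_exists_norm_sub_starProjection_le [CompleteSpace H] {K : Set H}
    (hK : IsClosed K) (hb : Bornology.IsBounded K)
    (h : ∀ δ : ℝ, 0 < δ → ∃ (V : Submodule ℝ H) (_ : FiniteDimensional ℝ V),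
      ∀ x ∈ K, ‖x - V.starProjection x‖ < δ) : IsCompact K := by
  refine (Metric.totallyBounded_iff.2 fun δ hδ ↦ ?_).isCompact_of_isClosed hK
  obtain ⟨V, hV, hVK⟩ := h (δ / 2) (half_pos hδ)
  obtain ⟨R, hR⟩ := hb.exists_norm_le
  have hC : TotallyBounded ((↑) '' Metric.closedBall (0 : V) R : Set H) :=
    ((isCompact_closedBall (0 : V) R).image continuous_subtype_val).totallyBounded
  obtain ⟨t, ht, hcov⟩ := Metric.totallyBounded_iff.1 hC (δ / 2) (half_pos hδ)
  refine ⟨t, ht, fun x hx ↦ ?_⟩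
  have hPx : V.starProjection x ∈ ((↑) '' Metric.closedBall (0 : V) R : Set H) := by
    refine ⟨V.orthogonalProjectionOnto x, ?_, rfl⟩
    rw [mem_closedBall_zero_iff]
    exact (V.norm_orthogonalProjectionOnto_apply_le x).trans (hR x hx)
  obtain ⟨y, hy, hxy⟩ := Set.mem_iUnion₂.1 (hcov hPx)
  refine Set.mem_iUnion₂.2 ⟨y, hy, ?_⟩
  rw [Metric.mem_ball] at hxy ⊢
  have h1 := dist_triangle x (V.starProjection x) y
  have h2 := hVK x hx
  rw [← dist_eq_norm] at h2
  linarith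

/-- A set of measures on a Hilbert space with bounded second moments is tight if the second
moments of the components orthogonal to suitable finite-dimensional subspaces are uniformly
small. -/
theorem isTightMeasureSet_of_lintegral_sub_starProjection_sq_le [CompleteSpace H]
    [MeasurableSpace H] [BorelSpace H]
    {S : Set (Measure H)} {M : ENNReal} (hM : M ≠ ⊤) (hS : ∀ μ ∈ S, ∫⁻ x, ‖x‖ₑ ^ 2 ∂μ ≤ M)
    (h : ∀ δ : ENNReal, 0 < δ → ∃ (V : Submodule ℝ H) (_ : FiniteDimensional ℝ V),
      ∀ μ ∈ S, ∫⁻ x, ‖x - V.starProjection x‖ₑ ^ 2 ∂μ ≤ δ) : IsTightMeasureSet S := by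
  rw [isTightMeasureSet_iff_exists_isCompact_measure_compl_le]
  intro ε hε
  rcases eq_or_ne ε ⊤ with rfl | hε'
  · exact ⟨∅, isCompact_empty, by simp⟩
  have hε2 : ε / 2 ≠ 0 := (ENNReal.half_pos hε.ne').ne'
  have hε2' : ε / 2 ≠ ⊤ := (ENNReal.half_lt_self hε.ne' hε').ne_top
  obtain ⟨η, hη, hηε⟩ := ENNReal.exists_pos_sum_of_countable hε2 ℕ
  have ha0 (j : ℕ) : ((j : ENNReal) + 1)⁻¹ ≠ 0 := by simp
  have ha1 (j : ℕ) : ((j : ENNReal) + 1)⁻¹ ≠ ⊤ := by simp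
  choose V hV hVS using fun j : ℕ ↦ h (η j * ((j : ENNReal) + 1)⁻¹)
    (ENNReal.mul_pos (by simpa using (hη j).ne') (ha0 j))
  set R : ENNReal := (M + 1) / (ε / 2) with hR
  have hR0 : R ≠ 0 := ENNReal.div_ne_zero.2 ⟨by simp, hε2'⟩
  have hRtop : R ≠ ⊤ := ENNReal.div_ne_top (by simpa using hM) hε2
  -- By Markov's inequality and the choice of the bounds, each of the events that define the
  -- complement of this set has small measure.
  set K : Set H := {x | ‖x‖ₑ ^ 2 ≤ R} ∩
    ⋂ j, {x | ‖x - (V j).starProjection x‖ₑ ^ 2 ≤ ((j : ENNReal) + 1)⁻¹} with hKdef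
  refine ⟨K, ?_, fun μ hμ ↦ ?_⟩
  · refine isCompact_of_forall_exists_norm_sub_starProjection_le ?_ ?_ fun δ hδ ↦ ?_
    · exact (isClosed_le (by fun_prop) continuous_const).inter
        (isClosed_iInter fun j ↦ isClosed_le (by fun_prop) continuous_const)
    · refine isBounded_iff_forall_norm_le.2 ⟨√R.toReal, fun x hx ↦ Real.le_sqrt_of_sq_le ?_⟩
      have := ENNReal.toReal_mono hRtop hx.1
      simpa using this
    · obtain ⟨j, hj⟩ := exists_nat_one_div_lt (pow_pos hδ 2)
      refine ⟨V j, hV j, fun x hx ↦ lt_of_pow_lt_pow_left₀ 2 hδ.le (lt_of_le_of_lt ?_ hj)⟩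
      have := ENNReal.toReal_mono (ha1 j) (Set.mem_iInter.1 hx.2 j)
      rw [ENNReal.toReal_inv, ENNReal.toReal_add (by simp) (by simp)] at this
      simpa using this
  · have h1 : μ {x | ‖x‖ₑ ^ 2 ≤ R}ᶜ ≤ ε / 2 := by
      refine measure_compl_setOf_le_le (by fun_prop) hR0 hRtop ((hS μ hμ).trans ?_)
      rw [hR, ENNReal.mul_div_cancel hε2 hε2']
      exact le_self_add
    have h2 (j : ℕ) :
        μ {x | ‖x - (V j).starProjection x‖ₑ ^ 2 ≤ ((j : ENNReal) + 1)⁻¹}ᶜ ≤ η j :=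
      measure_compl_setOf_le_le (Continuous.measurable (by fun_prop)).aemeasurable
        (ha0 j) (ha1 j) (hVS j μ hμ)
    calc μ Kᶜ ≤ μ {x | ‖x‖ₑ ^ 2 ≤ R}ᶜ +
          ∑' j, μ {x | ‖x - (V j).starProjection x‖ₑ ^ 2 ≤ ((j : ENNReal) + 1)⁻¹}ᶜ := by
          rw [hKdef, Set.compl_inter, Set.compl_iInter]
          exact (measure_union_le _ _).trans (by gcongr; exact measure_iUnion_le _)
      _ ≤ ε / 2 + ε / 2 := by
          gcongr
          exact (ENNReal.tsum_le_tsum h2).trans hηε.le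
      _ = ε := ENNReal.add_halves ε

/-- A square integrable random element of a separable Hilbert space is approximated in `L²` by
its projections to finite-dimensional subspaces. -/
theorem exists_finiteDimensional_integral_sub_starProjection_sq_le
    [TopologicalSpace.SeparableSpace H] {Ω : Type*} [MeasurableSpace Ω] {P : Measure Ω}
    {W : Ω → H} (hW : MemLp W 2 P) {δ : ℝ} (hδ : 0 < δ) :
    ∃ (V : Submodule ℝ H) (_ : FiniteDimensional ℝ V),
      ∫ ω, ‖W ω - V.starProjection (W ω)‖ ^ 2 ∂P ≤ δ := by
  set U : ℕ → Submodule ℝ H :=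
    fun k ↦ Submodule.span ℝ (TopologicalSpace.denseSeq H '' Set.Iio k) with hU
  have hfin (k : ℕ) : FiniteDimensional ℝ (U k) :=
    FiniteDimensional.span_of_finite ℝ ((Set.finite_Iio k).image _)
  have hmono : Monotone U := fun k l hkl ↦
    Submodule.span_mono (Set.image_mono (Set.Iio_subset_Iio hkl))
  have hdense : ⊤ ≤ (⨆ k, U k).topologicalClosure := by
    intro x _
    refine closure_mono ?_ (TopologicalSpace.denseRange_denseSeq H x)
    rintro _ ⟨k, rfl⟩
    exact Submodule.mem_iSup_of_mem (k + 1)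
      (Submodule.subset_span ⟨k, Nat.lt_succ_self k, rfl⟩)
  have hlim : Tendsto (fun k ↦ ∫ ω, ‖W ω - (U k).starProjection (W ω)‖ ^ 2 ∂P) atTop
      (𝓝 (∫ _, (0 : ℝ) ∂P)) := by
    refine tendsto_integral_of_dominated_convergence (fun ω ↦ (2 * ‖W ω‖) ^ 2) (fun k ↦ ?_) ?_
      (fun k ↦ ae_of_all _ fun ω ↦ ?_) (ae_of_all _ fun ω ↦ ?_)
    · exact ((hW.aestronglyMeasurable.sub
        ((U k).starProjection.continuous.comp_aestronglyMeasurable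
          hW.aestronglyMeasurable)).norm.pow 2)
    · simp_rw [mul_pow]
      exact (hW.integrable_norm_pow two_ne_zero).const_mul _
    · rw [Real.norm_of_nonneg (by positivity)]
      gcongr
      have := (U k).norm_starProjection_apply_le (W ω)
      linarith [norm_sub_le (W ω) ((U k).starProjection (W ω))]
    · have := (Submodule.starProjection_tendsto_self U hmono (W ω) hdense).const_sub (W ω)
      simpa using (this.norm.pow 2)
  obtain ⟨k, hk⟩ := (hlim.eventually_lt_const (by simpa using hδ)).exists
  exact ⟨U k, hfin k, hk.le⟩

end Tightness

/-! ### The central limit theorem in Hilbert spaces -/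

section CentralLimit

theorem map_inner_eq_gaussianReal_of_charFun_eq_exp {H : Type*}
    [NormedAddCommGroup H] [InnerProductSpace ℝ H] [SecondCountableTopology H]
    [MeasurableSpace H] [BorelSpace H] {ν : Measure H} [IsProbabilityMeasure ν] {v : H → ℝ}
    (hv0 : ∀ t, 0 ≤ v t) (hv : ∀ (r : ℝ) t, v (r • t) = r ^ 2 * v t)
    (h : ∀ t, charFun ν t = Complex.exp (-(v t : ℂ) / 2)) (t : H) :
    ν.map (fun x ↦ inner ℝ x t) = gaussianReal 0 (v t).toNNReal := by
  have : IsProbabilityMeasure (ν.map fun x ↦ inner ℝ x t) :=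
    Measure.isProbabilityMeasure_map (by fun_prop)
  refine Measure.ext_of_charFun (funext fun r ↦ ?_)
  have h1 : charFun (ν.map fun x ↦ inner ℝ x t) r = charFun ν (r • t) := by
    rw [charFun_apply, charFun_apply, integral_map (by fun_prop) (by fun_prop)]
    simp [inner_smul_right, mul_comm]
  rw [h1, h, hv, charFun_gaussianReal, Real.coe_toNNReal _ (hv0 t)]
  congr 1
  push_cast
  ring

variable {H : Type*} [NormedAddCommGroup H] [InnerProductSpace ℝ H] [CompleteSpace H]
  [SecondCountableTopology H] [MeasurableSpace H] [BorelSpace H]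

/-- A version of Lévy's convergence theorem in which tightness is assumed: the existence of the
limit measure follows from Prokhorov's theorem. -/
theorem exists_tendsto_of_isTightMeasureSet_of_tendsto_charFun {μ : ℕ → ProbabilityMeasure H}
    (htight : IsTightMeasureSet {(μ n : Measure H) | n}) {φ : H → ℂ}
    (hφ : ∀ t, Tendsto (fun n ↦ charFun (μ n) t) atTop (𝓝 (φ t))) :
    ∃ ν : ProbabilityMeasure H, (∀ t, charFun ν t = φ t) ∧ Tendsto μ atTop (𝓝 ν) := by
  have hcompact : IsCompact (closure {μ n | n}) :=
    isCompact_closure_of_isTightMeasureSet (by simpa using htight)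
  obtain ⟨ν, -, hν⟩ := hcompact.ultrafilter_le_nhds ((hyperfilter ℕ).map μ)
    (.trans (by simp) (monotone_principal subset_closure))
  have hν' : Tendsto μ (hyperfilter ℕ) (𝓝 ν) := hν
  have hle : (hyperfilter ℕ : Filter ℕ) ≤ atTop := Nat.hyperfilter_le_atTop
  have hchar (t : H) : charFun ν t = φ t := by
    rw [ProbabilityMeasure.tendsto_iff_forall_integral_rclike_tendsto ℂ] at hν'
    refine tendsto_nhds_unique ?_ ((hφ t).mono_left hle)
    simp_rw [charFun_eq_integral_innerProbChar]
    exact hν' (BoundedContinuousFunction.innerProbChar t)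
  refine ⟨ν, hchar, ?_⟩
  refine ProbabilityMeasure.tendsto_of_tight_of_separatesPoints htight (𝕜 := ℂ)
    (A := BoundedContinuousFunction.charPoly Real.continuous_probChar (L := innerₗ H)
      continuous_inner) ?_ ?_
  · refine BoundedContinuousFunction.separatesPoints_charPoly Real.continuous_probChar
      Real.probChar_ne_one _ ?_
    exact fun v hv ↦ DFunLike.ne_iff.mpr ⟨v, inner_self_ne_zero.mpr hv⟩
  · exact fun g ↦ ProbabilityMeasure.tendsto_charPoly_of_tendsto_charFun
      fun t ↦ by rw [hchar]; exact hφ t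

variable {Ω : Type*} [MeasurableSpace Ω] {P : Measure Ω} [IsProbabilityMeasure P]
  {W : ℕ → Ω → H}

/-- The laws of the normalised sums of an i.i.d. sequence of centred square integrable random
elements are tight, as the second moments of their components are bounded independently of the
number of summands. -/
theorem isTightMeasureSet_map_inv_sqrt_smul_sum (hindep : iIndepFun W P)
    (hident : ∀ i, IdentDistrib (W i) (W 0) P P) (hL2 : MemLp (W 0) 2 P)
    (h0 : ∫ ω, W 0 ω ∂P = 0) :
    IsTightMeasureSet
      {P.map (fun ω ↦ (√(n : ℝ))⁻¹ • ∑ i ∈ Finset.range n, W i ω) | n : ℕ} := by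
  have hWm (i : ℕ) : AEMeasurable (W i) P := (hident i).aemeasurable_fst
  have hSm (n : ℕ) :
      AEMeasurable (fun ω ↦ (√(n : ℝ))⁻¹ • ∑ i ∈ Finset.range n, W i ω) P :=
    (Finset.aemeasurable_fun_sum _ fun i _ ↦ hWm i).const_smul _
  -- Used below for the identity and for the projection to an orthogonal complement.
  have key (A : H →L[ℝ] H) (n : ℕ) :
      ∫⁻ x, ‖A x‖ₑ ^ 2 ∂(P.map (fun ω ↦ (√(n : ℝ))⁻¹ • ∑ i ∈ Finset.range n, W i ω)) ≤
        ENNReal.ofReal (∫ ω, ‖A (W 0 ω)‖ ^ 2 ∂P) := by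
    have hA2 (i : ℕ) : MemLp (fun ω ↦ A (W i ω)) 2 P :=
      A.comp_memLp' ((hident i).memLp_iff.2 hL2)
    rw [lintegral_map' (by fun_prop) (hSm n)]
    simp only [map_smul, map_sum]
    refine (lintegral_enorm_sq_eq_ofReal
      ((memLp_finsetSum _ fun i _ ↦ hA2 i).const_smul _)).trans_le (ENNReal.ofReal_le_ofReal ?_)
    refine integral_norm_inv_sqrt_smul_sum_sq_le (W := fun i ω ↦ A (W i ω))
      (hindep.comp (fun _ ↦ A) fun _ ↦ A.measurable)
      (fun i ↦ (hident i).comp A.measurable) (hA2 0) ?_ n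
    rw [A.integral_comp_comm (hL2.integrable (by norm_num)), h0, map_zero]
  refine isTightMeasureSet_of_lintegral_sub_starProjection_sq_le
    (M := ENNReal.ofReal (∫ ω, ‖W 0 ω‖ ^ 2 ∂P)) ENNReal.ofReal_ne_top ?_ fun δ hδ ↦ ?_
  · rintro _ ⟨n, rfl⟩
    exact key (ContinuousLinearMap.id ℝ H) n
  · obtain ⟨δ', hδ', hδδ'⟩ := ENNReal.lt_iff_exists_nnreal_btwn.1 hδ
    obtain ⟨V, hV, hVδ⟩ := exists_finiteDimensional_integral_sub_starProjection_sq_le hL2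
      (δ := δ') (by simpa using hδ')
    refine ⟨V, hV, ?_⟩
    rintro _ ⟨n, rfl⟩
    refine (key (ContinuousLinearMap.id ℝ H - V.starProjection) n).trans (le_trans ?_ hδδ'.le)
    exact ENNReal.ofReal_le_of_le_toReal hVδ

/-- The one-dimensional central limit theorem, applied to the projections to the lines. -/
theorem tendsto_charFun_map_inv_sqrt_smul_sum (hindep : iIndepFun W P)
    (hident : ∀ i, IdentDistrib (W i) (W 0) P P) (hL2 : MemLp (W 0) 2 P)
    (h0 : ∫ ω, W 0 ω ∂P = 0) (t : H) :
    Tendsto (fun n : ℕ ↦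
        charFun (P.map (fun ω ↦ (√(n : ℝ))⁻¹ • ∑ i ∈ Finset.range n, W i ω)) t) atTop
      (𝓝 (Complex.exp (-((∫ ω, inner ℝ (W 0 ω) t ^ 2 ∂P : ℝ) : ℂ) / 2))) := by
  have hf : Measurable fun x : H ↦ inner ℝ x t := by fun_prop
  have hX0 : MemLp (fun ω ↦ inner ℝ (W 0 ω) t) 2 P := hL2.inner_const t
  have hmean : ∫ ω, inner ℝ (W 0 ω) t ∂P = 0 := by
    simp_rw [real_inner_comm t]
    rw [integral_inner (hL2.integrable (by norm_num)), h0, inner_zero_right]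
  have hvar : Var[fun ω ↦ inner ℝ (W 0 ω) t; P] = ∫ ω, inner ℝ (W 0 ω) t ^ 2 ∂P :=
    variance_of_integral_eq_zero hX0.aestronglyMeasurable.aemeasurable hmean
  have hclt := tendstoInDistribution_inv_sqrt_mul_sum_sub
    (X := fun i ω ↦ inner ℝ (W i ω) t) (Y := id)
    (P' := gaussianReal 0 Var[fun ω ↦ inner ℝ (W 0 ω) t; P].toNNReal) HasLaw.id hX0
    (hindep.comp (fun _ x ↦ inner ℝ x t) fun _ ↦ hf) (fun i ↦ (hident i).comp hf)
  have hlim := ProbabilityMeasure.tendsto_iff_tendsto_charFun.1 hclt.tendsto 1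
  simp only [ProbabilityMeasure.coe_mk, Measure.map_id, charFun_gaussianReal, hmean] at hlim
  convert! hlim using 2 with n
  · rw [charFun_apply, charFun_apply, integral_map, integral_map]
    · simp [inner_smul_left, sum_inner]
    · simpa only [hmean] using hclt.forall_aemeasurable n
    · fun_prop
    · exact (Finset.aemeasurable_fun_sum _ fun i _ ↦ (hident i).aemeasurable_fst).const_smul _
    · fun_prop
  · rw [Real.coe_toNNReal _ (variance_nonneg _ _), hvar]
    simp [neg_div]

/-- Tightness and the limits of the characteristic functions yield a limit law with centred
Gaussian one-dimensional marginals. -/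
theorem exists_map_inner_eq_and_tendstoInDistribution (hindep : iIndepFun W P)
    (hident : ∀ i, IdentDistrib (W i) (W 0) P P) (hL2 : MemLp (W 0) 2 P)
    (h0 : ∫ ω, W 0 ω ∂P = 0) :
    ∃ ν : ProbabilityMeasure H,
      (∀ t, (ν : Measure H).map (fun x ↦ inner ℝ x t) =
        gaussianReal 0 (∫ ω, inner ℝ (W 0 ω) t ^ 2 ∂P).toNNReal) ∧
      TendstoInDistribution (fun (n : ℕ) ω ↦ (√(n : ℝ))⁻¹ • ∑ i ∈ Finset.range n, W i ω) atTop
        (fun x ↦ x) (fun _ ↦ P) (ν : Measure H) := by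
  have hSm (n : ℕ) :
      AEMeasurable (fun ω ↦ (√(n : ℝ))⁻¹ • ∑ i ∈ Finset.range n, W i ω) P :=
    (Finset.aemeasurable_fun_sum _ fun i _ ↦ (hident i).aemeasurable_fst).const_smul _
  obtain ⟨ν, hchar, hlim⟩ := exists_tendsto_of_isTightMeasureSet_of_tendsto_charFun
    (μ := fun n ↦ ⟨_, Measure.isProbabilityMeasure_map (hSm n)⟩)
    (isTightMeasureSet_map_inv_sqrt_smul_sum hindep hident hL2 h0)
    (tendsto_charFun_map_inv_sqrt_smul_sum hindep hident hL2 h0)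
  refine ⟨ν, map_inner_eq_gaussianReal_of_charFun_eq_exp
    (fun t ↦ integral_nonneg fun ω ↦ by positivity) (fun r t ↦ ?_) hchar, hSm, by fun_prop, ?_⟩
  · simp_rw [inner_smul_right, mul_pow]
    exact integral_const_mul _ _
  · exact hlim.trans (le_of_eq (congrArg 𝓝 (Subtype.ext Measure.map_id.symm)))

end CentralLimit

/-! ### Covariance operators -/

section Covariance

variable {H : Type*} [NormedAddCommGroup H] [InnerProductSpace ℝ H]
  {Ω Ω' : Type*} [MeasurableSpace Ω] [MeasurableSpace Ω'] {P : Measure Ω} {P' : Measure Ω'}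

theorem integral_inner_mul_inner_eq {Z : Ω → H} (hZ : MemLp Z 2 P) (s t : H) :
    ∫ ω, inner ℝ (Z ω) s * inner ℝ (Z ω) t ∂P =
      (∫ ω, inner ℝ (Z ω) (s + t) ^ 2 ∂P - ∫ ω, inner ℝ (Z ω) (s - t) ^ 2 ∂P) / 4 := by
  rw [← integral_sub (hZ.inner_const _).integrable_sq (hZ.inner_const _).integrable_sq,
    ← integral_div]
  congr 1 with ω
  rw [inner_add_right, inner_sub_right]
  ring

variable [CompleteSpace H]

theorem inner_covOp {Z : Ω → H} (hZ : MemLp Z 2 P) (h0 : ∫ ω, Z ω ∂P = 0) (s t : H) :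
    inner ℝ t (covOp Z P s) = ∫ ω, inner ℝ (Z ω) s * inner ℝ (Z ω) t ∂P := by
  have hint : Integrable (fun ω ↦ inner ℝ (Z ω) s • Z ω) P :=
    memLp_one_iff_integrable.1 (hZ.smul (hZ.inner_const s))
  simp only [covOp, h0, sub_zero]
  rw [← integral_inner hint]
  simp_rw [inner_smul_right, real_inner_comm t]

/-- By polarisation, the covariance operator of a centred random element is determined by the
variances of its components. -/
theorem covOp_eq_covOp_iff {Z : Ω → H} {Z' : Ω' → H} (hZ : MemLp Z 2 P) (hZ' : MemLp Z' 2 P')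
    (h0 : ∫ ω, Z ω ∂P = 0) (h0' : ∫ ω, Z' ω ∂P' = 0) :
    covOp Z P = covOp Z' P' ↔
      ∀ t, ∫ ω, inner ℝ (Z ω) t ^ 2 ∂P = ∫ ω, inner ℝ (Z' ω) t ^ 2 ∂P' := by
  refine ⟨fun h t ↦ ?_, fun h ↦ funext fun s ↦ ext_inner_left ℝ fun t ↦ ?_⟩
  · simp_rw [sq, ← inner_covOp hZ h0, ← inner_covOp hZ' h0', h]
  · rw [inner_covOp hZ h0, inner_covOp hZ' h0', integral_inner_mul_inner_eq hZ,
      integral_inner_mul_inner_eq hZ', h, h]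

variable [SecondCountableTopology H] [MeasurableSpace H] [BorelSpace H]

/-- A measure whose one-dimensional marginals are centred Gaussian with the variances of the
components of a centred random element `W` is centred Gaussian with the covariance operator
of `W`. -/
theorem isCenteredGaussian_of_map_inner_eq {ν : Measure H} [IsProbabilityMeasure ν] {W : Ω → H}
    (hW : MemLp W 2 P) (h0 : ∫ ω, W ω ∂P = 0)
    (h : ∀ t, ν.map (fun x ↦ inner ℝ x t) =
      gaussianReal 0 (∫ ω, inner ℝ (W ω) t ^ 2 ∂P).toNNReal) :
    IsCenteredGaussian (fun x : H ↦ x) ν (covOp W P) := by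
  have hν : IsGaussian ν := isGaussian_of_map_eq_gaussianReal fun L ↦ by
    have hL : (fun x ↦ inner ℝ x ((InnerProductSpace.toDual ℝ H).symm L)) = L := by
      ext x
      rw [real_inner_comm, InnerProductSpace.toDual_symm_apply]
    exact ⟨0, _, hL ▸ h ((InnerProductSpace.toDual ℝ H).symm L)⟩
  have hL2 : MemLp (fun x : H ↦ x) 2 ν := IsGaussian.memLp_two_id
  have hmean : ∫ x, x ∂ν = 0 := by
    refine ext_inner_left ℝ fun t ↦ ?_
    rw [← integral_inner (hL2.integrable (by norm_num)), inner_zero_right]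
    simp_rw [← real_inner_comm t]
    have := integral_map (μ := ν) (φ := fun x ↦ inner ℝ x t) (f := fun r : ℝ ↦ r)
      (by fun_prop) (by fun_prop)
    rw [← this, h, integral_id_gaussianReal]
  refine ⟨⟨by simpa using! hν⟩, hmean, (covOp_eq_covOp_iff hL2 hW hmean h0).2 fun t ↦ ?_⟩
  have hm := integral_map (μ := ν) (φ := fun x ↦ inner ℝ x t) (f := fun r : ℝ ↦ r ^ 2)
      (by fun_prop) (by fun_prop)
  rw [← hm, h, ← variance_of_integral_eq_zero (by fun_prop) integral_id_gaussianReal,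
    variance_fun_id_gaussianReal, Real.coe_toNNReal _ (integral_nonneg fun ω ↦ by positivity)]

theorem IsCenteredGaussian.charFun_map {Z : Ω → H} {C : H → H} (hZ : IsCenteredGaussian Z P C)
    (t : H) : charFun (P.map Z) t =
      Complex.exp (-((∫ ω, inner ℝ (Z ω) t ^ 2 ∂P : ℝ) : ℂ) / 2) := by
  have hZm := hZ.gaussian.aemeasurable
  have hmean : ∫ ω, inner ℝ t (Z ω) ∂P = 0 := by
    rw [integral_inner hZ.gaussian.integrable, hZ.mean, inner_zero_right]
  rw [hZ.gaussian.charFun_map_eq, variance_of_integral_eq_zero (by fun_prop) hmean, hmean]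
  simp [real_inner_comm t, neg_div]

/-- A centred Gaussian law is determined by its covariance operator. -/
theorem IsCenteredGaussian.map_eq {Z : Ω → H} {Z' : Ω' → H} {C : H → H}
    (hZ : IsCenteredGaussian Z P C) (hZ' : IsCenteredGaussian Z' P' C) :
    P.map Z = P'.map Z' := by
  have := hZ.gaussian.isGaussian_map
  have := hZ'.gaussian.isGaussian_map
  have hP := hZ.gaussian.isProbabilityMeasure
  have hP' := hZ'.gaussian.isProbabilityMeasure
  have hsq := (covOp_eq_covOp_iff hZ.gaussian.memLp_two hZ'.gaussian.memLp_two hZ.mean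
    hZ'.mean).1 (hZ.cov.trans hZ'.cov.symm)
  refine Measure.ext_of_charFun (funext fun t ↦ ?_)
  rw [hZ.charFun_map, hZ'.charFun_map, hsq]

end Covariance

/-- The **central limit theorem** in a separable Hilbert space, with the Gaussian limit
described by its covariance operator. -/
theorem exists_isCenteredGaussian_and_tendstoInDistribution {H : Type*}
    [NormedAddCommGroup H] [InnerProductSpace ℝ H] [CompleteSpace H]
    [SecondCountableTopology H] [MeasurableSpace H] [BorelSpace H]
    {Ω : Type*} [MeasurableSpace Ω] {P : Measure Ω} [IsProbabilityMeasure P] {W : ℕ → Ω → H}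
    (hindep : iIndepFun W P) (hident : ∀ i, IdentDistrib (W i) (W 0) P P)
    (hL2 : MemLp (W 0) 2 P) (h0 : ∫ ω, W 0 ω ∂P = 0) :
    ∃ ν : ProbabilityMeasure H,
      IsCenteredGaussian (fun x : H ↦ x) (ν : Measure H) (covOp (W 0) P) ∧
      TendstoInDistribution (fun (n : ℕ) ω ↦ (√(n : ℝ))⁻¹ • ∑ i ∈ Finset.range n, W i ω) atTop
        (fun x ↦ x) (fun _ ↦ P) (ν : Measure H) := by
  obtain ⟨ν, hν, hlim⟩ := exists_map_inner_eq_and_tendstoInDistribution hindep hident hL2 h0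
  exact ⟨ν, isCenteredGaussian_of_map_inner_eq hL2 h0 hν, hlim⟩

/-! ### Conditional moments of the error -/

section Conditional

variable {H : Type*} [MeasurableSpace H] {Ω : Type*} [MeasurableSpace Ω] {P : Measure Ω}
  [IsProbabilityMeasure P] {X : Ω → H} {ε : Ω → ℝ} {σ : ℝ}

/-- The condition `E(ε² | X) = σ²` in terms of measures. Unlike the pull-out property of
conditional expectations, this form needs no integrability of the functions of `X` that are
multiplied by `ε²`. -/
theorem map_withDensity_sq_of_condExp_sq_eq (hX : Measurable X) (hε2 : MemLp ε 2 P)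
    (hvar : P[fun ω ↦ ε ω ^ 2 | MeasurableSpace.comap X inferInstance] =ᵐ[P] fun _ ↦ σ ^ 2) :
    (P.withDensity fun ω ↦ ENNReal.ofReal (ε ω ^ 2)).map X =
      ENNReal.ofReal (σ ^ 2) • P.map X := by
  ext A hA
  have hXA : MeasurableSet (X ⁻¹' A) := hX hA
  rw [Measure.map_apply hX hA, withDensity_apply _ hXA, Measure.smul_apply, smul_eq_mul,
    Measure.map_apply hX hA, ← ofReal_integral_eq_lintegral_ofReal
      hε2.integrable_sq.integrableOn (ae_of_all _ fun ω ↦ by positivity),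
    ← setIntegral_condExp hX.comap_le hε2.integrable_sq ⟨A, hA, rfl⟩,
    integral_congr_ae (ae_restrict_of_ae hvar), setIntegral_const, smul_eq_mul, mul_comm,
    ENNReal.ofReal_mul (sq_nonneg σ), ofReal_measureReal]

theorem lintegral_sq_mul_comp_of_condExp_sq_eq (hX : Measurable X) (hε : Measurable ε)
    (hε2 : MemLp ε 2 P)
    (hvar : P[fun ω ↦ ε ω ^ 2 | MeasurableSpace.comap X inferInstance] =ᵐ[P] fun _ ↦ σ ^ 2)
    {g : H → ENNReal} (hg : Measurable g) :
    ∫⁻ ω, ENNReal.ofReal (ε ω ^ 2) * g (X ω) ∂P =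
      ENNReal.ofReal (σ ^ 2) * ∫⁻ ω, g (X ω) ∂P := by
  rw [← lintegral_map hg hX, ← smul_eq_mul (ENNReal.ofReal (σ ^ 2)), ← lintegral_smul_measure,
    ← map_withDensity_sq_of_condExp_sq_eq hX hε2 hvar, lintegral_map hg hX,
    lintegral_withDensity_eq_lintegral_mul _ (by fun_prop) (by fun_prop)]
  rfl

theorem integral_sq_smul_comp_of_condExp_sq_eq {E : Type*} [NormedAddCommGroup E]
    [NormedSpace ℝ E] (hX : Measurable X) (hε : Measurable ε) (hε2 : MemLp ε 2 P)
    (hvar : P[fun ω ↦ ε ω ^ 2 | MeasurableSpace.comap X inferInstance] =ᵐ[P] fun _ ↦ σ ^ 2)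
    {g : H → E} (hg : StronglyMeasurable g) :
    ∫ ω, ε ω ^ 2 • g (X ω) ∂P = σ ^ 2 • ∫ ω, g (X ω) ∂P := by
  have h := integral_smul_measure (μ := P.map X) g (ENNReal.ofReal (σ ^ 2))
  rw [← map_withDensity_sq_of_condExp_sq_eq hX hε2 hvar,
    integral_map hX.aemeasurable hg.aestronglyMeasurable,
    integral_map hX.aemeasurable hg.aestronglyMeasurable,
    integral_withDensity_eq_integral_toReal_smul (by fun_prop) (by simp)] at h
  simpa only [ENNReal.toReal_ofReal (sq_nonneg _)] using h

end Conditional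

/-! ### The regression model -/

section Regression

variable {H : Type*} [NormedAddCommGroup H] [InnerProductSpace ℝ H]
  [SecondCountableTopology H] [MeasurableSpace H] [BorelSpace H]
  {Ω : Type*} [MeasurableSpace Ω] {P : Measure Ω} [IsProbabilityMeasure P]
  {X : Ω → H} {Y ε : Ω → ℝ} {Θ : H} {b σ : ℝ}

theorem memLp_smul_sub_const (hX : Measurable X) (hε : Measurable ε) (hε2 : MemLp ε 2 P)
    (hvar : P[fun ω ↦ ε ω ^ 2 | MeasurableSpace.comap X inferInstance] =ᵐ[P] fun _ ↦ σ ^ 2)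
    (hX2 : MemLp X 2 P) (m : H) : MemLp (fun ω ↦ ε ω • (X ω - m)) 2 P := by
  refine ⟨by fun_prop, ?_⟩
  have hXm : MemLp (fun ω ↦ X ω - m) 2 P := hX2.sub (memLp_const m)
  rw [eLpNorm_lt_top_iff_lintegral_rpow_enorm_lt_top (by norm_num) (by norm_num)]
  have h1 := lintegral_rpow_enorm_lt_top_of_eLpNorm_lt_top (by norm_num) (by norm_num) hXm.2
  simp only [ENNReal.toReal_ofNat, ENNReal.rpow_ofNat] at h1 ⊢
  have h2 := lintegral_sq_mul_comp_of_condExp_sq_eq hX hε hε2 hvar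
    (g := fun x ↦ ‖x - m‖ₑ ^ 2) (by fun_prop)
  simp_rw [enorm_smul, mul_pow]
  have h3 (ω : Ω) : ‖ε ω‖ₑ ^ 2 = ENNReal.ofReal (ε ω ^ 2) := by
    rw [← ofReal_norm, ← ENNReal.ofReal_pow (norm_nonneg _), Real.norm_eq_abs, sq_abs]
  simp_rw [h3, h2]
  exact ENNReal.mul_lt_top ENNReal.ofReal_lt_top h1

variable [CompleteSpace H]

theorem integral_smul_sub_const (hX : Measurable X) (hε2 : MemLp ε 2 P)
    (hmean : P[ε | MeasurableSpace.comap X inferInstance] =ᵐ[P] fun _ ↦ 0)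
    (hX2 : MemLp X 2 P) (m : H) : ∫ ω, ε ω • (X ω - m) ∂P = 0 := by
  have hint : Integrable (ε • fun ω ↦ X ω - m) P :=
    memLp_one_iff_integrable.1 ((hX2.sub (memLp_const m)).smul hε2)
  have hsm : StronglyMeasurable[MeasurableSpace.comap X inferInstance] fun ω ↦ X ω - m :=
    Measurable.stronglyMeasurable ((comap_measurable X).sub_const m)
  have h := condExp_smul_of_aestronglyMeasurable_right (hε2.integrable (by norm_num)) hint
    hsm.aestronglyMeasurable
  calc ∫ ω, ε ω • (X ω - m) ∂P
      = ∫ ω, (P[ε • fun ω ↦ X ω - m | MeasurableSpace.comap X inferInstance]) ω ∂P :=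
        (integral_condExp hX.comap_le).symm
    _ = ∫ _, (0 : H) ∂P := by
        refine integral_congr_ae ?_
        filter_upwards [h, hmean] with ω h1 h2
        rw [h1, Pi.smul_apply', h2, zero_smul]
    _ = 0 := by simp

theorem covOp_smul_sub_integral (hX : Measurable X) (hε : Measurable ε) (hε2 : MemLp ε 2 P)
    (hmean : P[ε | MeasurableSpace.comap X inferInstance] =ᵐ[P] fun _ ↦ 0)
    (hvar : P[fun ω ↦ ε ω ^ 2 | MeasurableSpace.comap X inferInstance] =ᵐ[P] fun _ ↦ σ ^ 2)
    (hX2 : MemLp X 2 P) :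
    covOp (fun ω ↦ ε ω • (X ω - ∫ ω', X ω' ∂P)) P = σ ^ 2 • covOp X P := by
  funext h
  simp only [covOp, integral_smul_sub_const hX hε2 hmean hX2, sub_zero, Pi.smul_apply]
  rw [← integral_sq_smul_comp_of_condExp_sq_eq hX hε hε2 hvar
    (g := fun x ↦ inner ℝ (x - ∫ ω', X ω' ∂P) h • (x - ∫ ω', X ω' ∂P))
    (Measurable.stronglyMeasurable (by fun_prop))]
  congr 1 with ω
  rw [inner_smul_left, smul_smul, smul_smul, RCLike.conj_to_real]
  congr 1
  ring

/-- If the cross-covariance of `X` and `Y` vanishes, then it does so in the direction of the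
slope, so that `⟨Θ, X⟩` has variance zero and only the error is left of `Y - E(Y)`. -/
theorem sub_integral_ae_eq_of_crossCov_eq_zero (hX : Measurable X)
    (hmodel : ∀ᵐ ω ∂P, Y ω = inner ℝ Θ (X ω) + b + ε ω) (hε2 : MemLp ε 2 P)
    (hmean : P[ε | MeasurableSpace.comap X inferInstance] =ᵐ[P] fun _ ↦ 0)
    (hX2 : MemLp X 2 P) (hY2 : MemLp Y 2 P) (h0 : crossCov X Y P = 0) :
    ∀ᵐ ω ∂P, Y ω - ∫ ω', Y ω' ∂P = ε ω := by
  have hXi : Integrable X P := hX2.integrable (by norm_num)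
  have hεi : Integrable ε P := hε2.integrable (by norm_num)
  have hε0 : ∫ ω, ε ω ∂P = 0 := by
    rw [← integral_condExp hX.comap_le, integral_congr_ae hmean, integral_zero]
  have hΘX : Integrable (fun ω ↦ inner ℝ Θ (X ω)) P := hXi.const_inner Θ
  have hYmean : ∫ ω, Y ω ∂P = inner ℝ Θ (∫ ω, X ω ∂P) + b := by
    have hΘXb : Integrable (fun ω ↦ inner ℝ Θ (X ω) + b) P := hΘX.add (integrable_const b)
    rw [integral_congr_ae hmodel, integral_add hΘXb hεi, integral_add hΘX (integrable_const b),
      integral_inner hXi, hε0]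
    simp
  set m := ∫ ω, X ω ∂P with hm
  have hYc : ∀ᵐ ω ∂P, Y ω - ∫ ω', Y ω' ∂P = inner ℝ (X ω - m) Θ + ε ω := by
    filter_upwards [hmodel] with ω h
    rw [h, hYmean, inner_sub_left, real_inner_comm Θ, real_inner_comm Θ]
    ring
  have hXm : MemLp (fun ω ↦ X ω - m) 2 P := hX2.sub (memLp_const m)
  have hsq : Integrable (fun ω ↦ inner ℝ (X ω - m) Θ ^ 2) P := (hXm.inner_const Θ).integrable_sq
  have hW : Integrable (fun ω ↦ ε ω • (X ω - m)) P :=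
    memLp_one_iff_integrable.1 (hXm.smul hε2)
  have hzero : ∫ ω, inner ℝ (X ω - m) Θ ^ 2 ∂P = 0 := by
    have h1 : crossCov X Y P Θ = 0 := by rw [h0, zero_apply]
    have h2 : ∫ ω, inner ℝ Θ (ε ω • (X ω - m)) ∂P = 0 := by
      rw [integral_inner hW, integral_smul_sub_const hX hε2 hmean hX2, inner_zero_right]
    rw [crossCov_apply hX2 hY2, ← hm] at h1
    rw [← h1, ← add_zero (∫ ω, inner ℝ (X ω - m) Θ ^ 2 ∂P), ← h2,
      ← integral_add hsq (hW.const_inner Θ)]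
    refine integral_congr_ae ?_
    filter_upwards [hYc] with ω h
    rw [h, inner_smul_right, real_inner_comm]
    ring
  rw [integral_eq_zero_iff_of_nonneg (fun ω ↦ by positivity) hsq] at hzero
  filter_upwards [hzero, hYc] with ω h1 h2
  have h3 : inner ℝ (X ω - m) Θ = 0 := by simpa using h1
  rw [h2, h3, zero_add]

end Regression

/-! ### The empirical cross-covariance -/

/-- The normalised statistic is, up to a product of normalised sums that is of smaller order, a
normalised sum. This holds for all centring constants `m` and `c`. -/
theorem sqrt_smul_empCrossCov {H : Type*} [AddCommGroup H] [Module ℝ H] (x : ℕ → H) (y : ℕ → ℝ)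
    (m : H) (c : ℝ) (n : ℕ) :
    √(n : ℝ) • empCrossCov x y n =
      (√(n : ℝ))⁻¹ • ∑ i ∈ Finset.range n, (y i - c) • (x i - m) -
        (√(n : ℝ))⁻¹ • (((√(n : ℝ))⁻¹ • ∑ i ∈ Finset.range n, (y i - c)) •
          ((√(n : ℝ))⁻¹ • ∑ i ∈ Finset.range n, (x i - m))) := by
  rcases eq_or_ne n 0 with rfl | hn
  · simp [empCrossCov]
  have hn0 : (n : ℝ) ≠ 0 := by exact_mod_cast hn
  set u : ℕ → ℝ := fun i ↦ y i - c with hu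
  set v : ℕ → H := fun i ↦ x i - m with hv
  have hy (i : ℕ) : y i - sampleMean y n = u i - (n : ℝ)⁻¹ * ∑ j ∈ Finset.range n, u j := by
    simp only [sampleMean, hu, Finset.sum_sub_distrib, Finset.sum_const, Finset.card_range,
      nsmul_eq_mul, smul_eq_mul]
    field_simp
    ring
  have hx (i : ℕ) : x i - sampleMean x n = v i - (n : ℝ)⁻¹ • ∑ j ∈ Finset.range n, v j := by
    simp only [sampleMean, hv, Finset.sum_sub_distrib, Finset.sum_const, Finset.card_range,
      smul_sub, ← Nat.cast_smul_eq_nsmul ℝ, inv_smul_smul₀ hn0]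
    abel
  have hsum : ∑ i ∈ Finset.range n, (y i - sampleMean y n) • (x i - sampleMean x n) =
      ∑ i ∈ Finset.range n, u i • v i -
        ((n : ℝ)⁻¹ * ∑ j ∈ Finset.range n, u j) • ∑ j ∈ Finset.range n, v j := by
    have hzero : ∑ i ∈ Finset.range n, (u i - (n : ℝ)⁻¹ * ∑ j ∈ Finset.range n, u j) = 0 := by
      simp [Finset.sum_sub_distrib, mul_inv_cancel_left₀ hn0]
    simp_rw [hy, hx, smul_sub, Finset.sum_sub_distrib, ← Finset.sum_smul, hzero, zero_smul,
      sub_zero, sub_smul, Finset.sum_sub_distrib, ← Finset.smul_sum]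
  have hs : √(n : ℝ) * (n : ℝ)⁻¹ = (√(n : ℝ))⁻¹ := by
    rw [← div_eq_mul_inv, Real.sqrt_div_self']; exact one_div _
  have hs2 : (√(n : ℝ))⁻¹ * (√(n : ℝ))⁻¹ = (n : ℝ)⁻¹ := by
    rw [← mul_inv, Real.mul_self_sqrt (Nat.cast_nonneg n)]
  rw [empCrossCov, hsum, smul_smul, hs, smul_sub]
  simp only [smul_smul, smul_eq_mul]
  congr 2
  rw [← hs2]
  ring

/-- The error term of the normalised statistic tends to zero in `L¹` and thus in probability, as
the two normalised sums are bounded in `L²`. -/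
theorem tendstoInMeasure_inv_sqrt_smul_smul {H : Type*} [NormedAddCommGroup H]
    [InnerProductSpace ℝ H] [CompleteSpace H] [SecondCountableTopology H] [MeasurableSpace H]
    [BorelSpace H] {Ω : Type*} [MeasurableSpace Ω] {P : Measure Ω} [IsFiniteMeasure P]
    {U : ℕ → Ω → ℝ} {V : ℕ → Ω → H}
    (hU : iIndepFun U P) (hU' : ∀ i, IdentDistrib (U i) (U 0) P P) (hU2 : MemLp (U 0) 2 P)
    (hU0 : ∫ ω, U 0 ω ∂P = 0)
    (hV : iIndepFun V P) (hV' : ∀ i, IdentDistrib (V i) (V 0) P P) (hV2 : MemLp (V 0) 2 P)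
    (hV0 : ∫ ω, V 0 ω ∂P = 0) :
    TendstoInMeasure P (fun (n : ℕ) ω ↦ (√(n : ℝ))⁻¹ •
      (((√(n : ℝ))⁻¹ • ∑ i ∈ Finset.range n, U i ω) •
        ((√(n : ℝ))⁻¹ • ∑ i ∈ Finset.range n, V i ω))) atTop (fun _ ↦ 0) := by
  have hA (n : ℕ) : MemLp (fun ω ↦ (√(n : ℝ))⁻¹ • ∑ i ∈ Finset.range n, U i ω) 2 P :=
    (memLp_finsetSum (Finset.range n) fun i _ ↦ (hU' i).memLp_iff.2 hU2).const_smul (√(n : ℝ))⁻¹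
  have hB (n : ℕ) : MemLp (fun ω ↦ (√(n : ℝ))⁻¹ • ∑ i ∈ Finset.range n, V i ω) 2 P :=
    (memLp_finsetSum (Finset.range n) fun i _ ↦ (hV' i).memLp_iff.2 hV2).const_smul (√(n : ℝ))⁻¹
  set A : ℕ → Ω → ℝ := fun n ω ↦ (√(n : ℝ))⁻¹ • ∑ i ∈ Finset.range n, U i ω
  set B : ℕ → Ω → H := fun n ω ↦ (√(n : ℝ))⁻¹ • ∑ i ∈ Finset.range n, V i ω
  set C : ℝ := (∫ ω, ‖U 0 ω‖ ^ 2 ∂P + ∫ ω, ‖V 0 ω‖ ^ 2 ∂P) / 2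
  have hAB (n : ℕ) : Integrable (fun ω ↦ (√(n : ℝ))⁻¹ • (A n ω • B n ω)) P :=
    (memLp_one_iff_integrable.1 ((hB n).smul (hA n))).smul _
  have hint (n : ℕ) : ∫ ω, ‖(√(n : ℝ))⁻¹ • (A n ω • B n ω)‖ ∂P ≤ (√(n : ℝ))⁻¹ * C := by
    have hA' := (hA n).integrable_norm_pow two_ne_zero
    have hB' := (hB n).integrable_norm_pow two_ne_zero
    calc ∫ ω, ‖(√(n : ℝ))⁻¹ • (A n ω • B n ω)‖ ∂P
        ≤ ∫ ω, (√(n : ℝ))⁻¹ * ((‖A n ω‖ ^ 2 + ‖B n ω‖ ^ 2) / 2) ∂P := by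
          refine integral_mono (hAB n).norm (((hA'.add hB').div_const 2).const_mul _) fun ω ↦ ?_
          simp only [norm_smul, norm_inv, Real.norm_of_nonneg (Real.sqrt_nonneg _)]
          gcongr
          linarith [two_mul_le_add_sq ‖A n ω‖ ‖B n ω‖]
      _ = (√(n : ℝ))⁻¹ * ((∫ ω, ‖A n ω‖ ^ 2 ∂P + ∫ ω, ‖B n ω‖ ^ 2 ∂P) / 2) := by
          rw [integral_const_mul, integral_div, integral_add hA' hB']
      _ ≤ (√(n : ℝ))⁻¹ * C := by
          gcongr
          exact div_le_div_of_nonneg_right (add_le_add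
            (integral_norm_inv_sqrt_smul_sum_sq_le hU hU' hU2 hU0 n)
            (integral_norm_inv_sqrt_smul_sum_sq_le hV hV' hV2 hV0 n)) zero_le_two
  have hlim : Tendsto (fun n : ℕ ↦ (√(n : ℝ))⁻¹ * C) atTop (𝓝 0) := by
    simpa using (tendsto_inv_atTop_zero.comp
      (Real.tendsto_sqrt_atTop.comp tendsto_natCast_atTop_atTop)).mul_const C
  refine tendstoInMeasure_of_tendsto_eLpNorm one_ne_zero
    (fun n ↦ (hAB n).aestronglyMeasurable) aestronglyMeasurable_const ?_
  refine tendsto_of_tendsto_of_tendsto_of_le_of_le tendsto_const_nhds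
    (h := fun n : ℕ ↦ ENNReal.ofReal ((√(n : ℝ))⁻¹ * C))
    (by simpa using ENNReal.tendsto_ofReal hlim) (fun n ↦ zero_le) fun n ↦ ?_
  have h0 : ((fun ω ↦ (√(n : ℝ))⁻¹ • (A n ω • B n ω)) - fun _ ↦ (0 : H)) =
      fun ω ↦ (√(n : ℝ))⁻¹ • (A n ω • B n ω) := sub_zero _
  change eLpNorm ((fun ω ↦ (√(n : ℝ))⁻¹ • (A n ω • B n ω)) - fun _ ↦ (0 : H)) 1 P ≤ _
  rw [h0, eLpNorm_one_eq_lintegral_enorm, ← ofReal_integral_norm_eq_lintegral_enorm (hAB n)]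
  exact ENNReal.ofReal_le_ofReal (hint n)

/-- The statistic of an i.i.d. sample has the same limit in law as the normalised sum of the
products of the centred variables. -/
theorem tendstoInDistribution_sqrt_smul_empCrossCov {H : Type*} [NormedAddCommGroup H]
    [InnerProductSpace ℝ H] [CompleteSpace H] [SecondCountableTopology H] [MeasurableSpace H]
    [BorelSpace H] {Ω Ω' : Type*} [MeasurableSpace Ω] [MeasurableSpace Ω'] {P : Measure Ω}
    {P' : Measure Ω'} [IsProbabilityMeasure P] [IsProbabilityMeasure P']
    {x : ℕ → Ω → H} {y : ℕ → Ω → ℝ} {Z : Ω' → H}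
    (hindep : iIndepFun (fun i ω ↦ (x i ω, y i ω)) P)
    (hident : ∀ i, IdentDistrib (fun ω ↦ (x i ω, y i ω)) (fun ω ↦ (x 0 ω, y 0 ω)) P P)
    (hx : MemLp (x 0) 2 P) (hy : MemLp (y 0) 2 P)
    (hZ : TendstoInDistribution (fun (n : ℕ) ω ↦ (√(n : ℝ))⁻¹ • ∑ i ∈ Finset.range n,
      (y i ω - ∫ ω', y 0 ω' ∂P) • (x i ω - ∫ ω', x 0 ω' ∂P)) atTop Z (fun _ ↦ P) P') :
    TendstoInDistribution
      (fun (n : ℕ) ω ↦ √(n : ℝ) • empCrossCov (fun i ↦ x i ω) (fun i ↦ y i ω) n)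
      atTop Z (fun _ ↦ P) P' := by
  set m := ∫ ω, x 0 ω ∂P with hm
  set c := ∫ ω, y 0 ω ∂P with hc
  have hxm : Measurable fun p : H × ℝ ↦ p.1 - m := by fun_prop
  have hyc : Measurable fun p : H × ℝ ↦ p.2 - c := by fun_prop
  have hxa (i : ℕ) : AEMeasurable (x i) P := measurable_fst.comp_aemeasurable
    (hident i).aemeasurable_fst
  have hya (i : ℕ) : AEMeasurable (y i) P := measurable_snd.comp_aemeasurable
    (hident i).aemeasurable_fst
  have hR := tendstoInMeasure_inv_sqrt_smul_smul
    (U := fun i ω ↦ y i ω - c) (V := fun i ω ↦ x i ω - m)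
    (hindep.comp (fun _ p ↦ p.2 - c) fun _ ↦ hyc) (fun i ↦ (hident i).comp hyc)
    (hy.sub (memLp_const c))
    (by rw [integral_sub (hy.integrable (by norm_num)) (integrable_const c)]; simp [hc])
    (hindep.comp (fun _ p ↦ p.1 - m) fun _ ↦ hxm) (fun i ↦ (hident i).comp hxm)
    (hx.sub (memLp_const m))
    (by rw [integral_sub (hx.integrable (by norm_num)) (integrable_const m)]; simp [hm])
  have hRm (n : ℕ) : AEMeasurable (fun ω ↦ (√(n : ℝ))⁻¹ •
      (((√(n : ℝ))⁻¹ • ∑ i ∈ Finset.range n, (y i ω - c)) •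
        ((√(n : ℝ))⁻¹ • ∑ i ∈ Finset.range n, (x i ω - m)))) P := by fun_prop
  have h := hZ.continuous_comp_prodMk_of_tendstoInMeasure_const
    (g := fun p : H × H ↦ p.1 - p.2) (by fun_prop) hR hRm
  simp only [sub_zero] at h
  simp_rw [sqrt_smul_empCrossCov _ _ m c]
  exact h

/-! ### The limit law of the statistic -/

theorem corollary1
    {H : Type*} [NormedAddCommGroup H] [InnerProductSpace ℝ H] [CompleteSpace H]
    [TopologicalSpace.SeparableSpace H] [MeasurableSpace H] [BorelSpace H]
    -- the model `Y = ⟨Θ, X⟩ + b + ε`, `E(ε | X) = 0`, `E(ε² | X) = σ²`, `E‖X‖⁴ < ∞`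
    {Ω : Type*} [MeasurableSpace Ω] (P : Measure Ω) [IsProbabilityMeasure P]
    (X : Ω → H) (Y ε : Ω → ℝ) (Θ : H) (b σ : ℝ)
    (hX : Measurable X) (hY : Measurable Y) (hε : Measurable ε)
    (hmodel : ∀ᵐ ω ∂P, Y ω = inner ℝ Θ (X ω) + b + ε ω)
    (hε2 : MemLp ε 2 P)
    (hmean : P[ε | MeasurableSpace.comap X inferInstance] =ᵐ[P] fun _ ↦ 0)
    (hvar : P[fun ω ↦ ε ω ^ 2 | MeasurableSpace.comap X inferInstance] =ᵐ[P] fun _ ↦ σ ^ 2)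
    (hX4 : MemLp X 4 P)
    -- the null hypothesis
    (hH0 : ‖crossCov X Y P‖ = 0)
    -- an i.i.d. sample with the law of `(X, Y)`
    {Ω₀ : Type*} [MeasurableSpace Ω₀] (P₀ : Measure Ω₀) [IsProbabilityMeasure P₀]
    (Xs : ℕ → Ω₀ → H) (Ys : ℕ → Ω₀ → ℝ)
    (hindep : iIndepFun (fun i ω ↦ (Xs i ω, Ys i ω)) P₀)
    (hident : ∀ i, IdentDistrib (fun ω ↦ (Xs i ω, Ys i ω)) (fun ω ↦ (X ω, Y ω)) P₀ P) :
    -- `(X - μ_X) ε` is square integrable, with covariance operator `σ² Γ`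
    MemLp (fun ω ↦ ε ω • (X ω - ∫ ω', X ω' ∂P)) 2 P ∧
    covOp (fun ω ↦ ε ω • (X ω - ∫ ω', X ω' ∂P)) P = σ ^ 2 • covOp X P ∧
    -- a centred Gaussian element with this covariance operator exists
    (∃ ν : Measure H, IsCenteredGaussian (fun x : H ↦ x) ν
      (covOp (fun ω ↦ ε ω • (X ω - ∫ ω', X ω' ∂P)) P)) ∧
    -- and every such element `Z` is the limit in law, as is its norm for the norms
    ∀ (Ω' : Type*) [MeasurableSpace Ω'] (P' : Measure Ω') [IsProbabilityMeasure P'] (Z : Ω' → H),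
      IsCenteredGaussian Z P' (covOp (fun ω ↦ ε ω • (X ω - ∫ ω', X ω' ∂P)) P) →
      TendstoInDistribution
        (fun (n : ℕ) ω ↦ √(n : ℝ) • empCrossCov (fun i ↦ Xs i ω) (fun i ↦ Ys i ω) n)
        atTop Z (fun _ ↦ P₀) P' ∧
      TendstoInDistribution
        (fun (n : ℕ) ω ↦ ‖√(n : ℝ) • empCrossCov (fun i ↦ Xs i ω) (fun i ↦ Ys i ω) n‖)
        atTop (fun ω ↦ ‖Z ω‖) (fun _ ↦ P₀) P' := by
  have : SecondCountableTopology H := UniformSpace.secondCountable_of_separable H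
  have hX2 : MemLp X 2 P := hX4.mono_exponent (by norm_num)
  have hY2 : MemLp Y 2 P := by
    have h : MemLp (fun ω ↦ inner ℝ Θ (X ω) + b + ε ω) 2 P :=
      ((hX2.const_inner (𝕜 := ℝ) Θ).add (memLp_const b)).add hε2
    exact h.ae_eq (EventuallyEq.symm hmodel)
  have hW2 := memLp_smul_sub_const hX hε hε2 hvar hX2 (∫ ω, X ω ∂P)
  have hW0 := integral_smul_sub_const hX hε2 hmean hX2 (∫ ω, X ω ∂P)
  have hYε := sub_integral_ae_eq_of_crossCov_eq_zero hX hmodel hε2 hmean hX2 hY2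
    (norm_eq_zero.1 hH0)
  set W : Ω → H := fun ω ↦ ε ω • (X ω - ∫ ω', X ω' ∂P) with hW
  have hXs : IdentDistrib (Xs 0) X P₀ P := (hident 0).comp measurable_fst
  have hYs : IdentDistrib (Ys 0) Y P₀ P := (hident 0).comp measurable_snd
  -- The products of the centred variables of the sample have the law of `W`, as the null
  -- hypothesis identifies `Y - E(Y)` with the error.
  set g : H × ℝ → H := fun p ↦ (p.2 - ∫ ω, Ys 0 ω ∂P₀) • (p.1 - ∫ ω, Xs 0 ω ∂P₀) with hg
  have hgm : Measurable g := by fun_prop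
  have hWs (i : ℕ) : IdentDistrib (fun ω ↦ g (Xs i ω, Ys i ω)) W P₀ P := by
    refine ((hident i).comp hgm).trans (IdentDistrib.of_ae_eq (by fun_prop) ?_)
    filter_upwards [hYε] with ω h
    simp only [Function.comp_apply, hg, hW, hXs.integral_eq, hYs.integral_eq, h]
  obtain ⟨ν, hν, hlim⟩ := exists_isCenteredGaussian_and_tendstoInDistribution
    (W := fun i ω ↦ g (Xs i ω, Ys i ω)) (hindep.comp (fun _ ↦ g) fun _ ↦ hgm)
    (fun i ↦ (hWs i).trans (hWs 0).symm) ((hWs 0).memLp_iff.2 hW2)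
    ((hWs 0).integral_eq.trans hW0)
  have hcov : covOp (fun ω ↦ g (Xs 0 ω, Ys 0 ω)) P₀ = covOp W P :=
    (covOp_eq_covOp_iff ((hWs 0).memLp_iff.2 hW2) hW2 ((hWs 0).integral_eq.trans hW0) hW0).2
      fun t ↦ ((hWs 0).comp (u := fun x ↦ inner ℝ x t ^ 2) (by fun_prop)).integral_eq
  rw [hcov] at hν
  refine ⟨hW2, covOp_smul_sub_integral hX hε hε2 hmean hvar hX2, ⟨ν, hν⟩,
    fun Ω' _ P' _ Z hZ ↦ ?_⟩
  have hZlim : TendstoInDistribution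
      (fun (n : ℕ) ω ↦ (√(n : ℝ))⁻¹ • ∑ i ∈ Finset.range n, g (Xs i ω, Ys i ω)) atTop Z
      (fun _ ↦ P₀) P' := by
    refine ⟨hlim.forall_aemeasurable, hZ.gaussian.aemeasurable, ?_⟩
    exact hlim.tendsto.trans (le_of_eq (congrArg 𝓝 (Subtype.ext (hν.map_eq hZ))))
  have hT := tendstoInDistribution_sqrt_smul_empCrossCov hindep
    (fun i ↦ (hident i).trans (hident 0).symm) (hXs.memLp_iff.2 hX2) (hYs.memLp_iff.2 hY2) hZlim
  exact ⟨hT, hT.continuous_comp continuous_norm⟩
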